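/- **Setting.** Let $C_x\subseteq\mathbb R^n$, $C_u\subseteq\mathbb R^m$, let $F:\mathbb R^n\times\mathbb R^m\rightrightarrows\mathbb R^n$ and $\mathcal U:C_x\rightrightarrows C_u$ be set-valued maps, and consider the constrained system $\dot x\in F(x,u)$, $u\in\mathcal U(x)$, $x\in C_x$. Assume: 1. $C=C_x\times C_u$ is closed. 2. On $C$, $F$ has nonempty, compact, convex values and is upper semicontinuous: for every $z\in C$ and $\varepsilon>0$, $F(z')\subseteq F(z)+\varepsilon\mathbb B$ for all $z'\in C$ near $z$, where $\mathbb B$ is the closed unit ball. 3. $\mathcal U$ is lower semicontinuous on $C_x$ (if $V$ is open and $\mathcal U(x)\cap V\neq\emptyset$, then $\mathcal U(x')\cap V\ne\emptyset$ for all $x'\in C_x$ near $x$), with nonempty, closed, convex values contained in $C_u$. 4. $F$ is convex in $u$: $C_u$ is convex and, for $x\in C_x$, $u,v\in C_u$, $\theta\in[0,1]$, $F(x,\theta u+(1-\theta)v)\subseteq\theta F(x,u)+(1-\theta)F(x,v)$. For a locally Lipschitz $B:\mathbb R^n\to\mathbb R$, let $\partial_CB(x)=\operatorname{co}\{\lim_i\nabla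 B(x_i): x_i\to x,\ B\text{ differentiable at }x_i,\ x_i\notin\Omega\}$ be the Clarke generalized gradient, where $\Omega\subset\mathbb R^n$ is an arbitrary fixed Lebesgue null set, and let $$g(x,u)=\sup\{\langle\zeta,\eta\rangle:\zeta\in\partial_CB(x),\ \eta\in F(x,u)\},\qquad D_0(x)=\{u\in\mathcal U(x): g(x,u)<0\}.$$ A solution of $\dot x\in G(x)$, $x\in C_x$, is a locally absolutely continuous function $x$ on an interval $\operatorname{dom}x\subseteq[0,\infty)$ containing $0$, with $x(0)\in\operatorname{cl}(C_x)$, $x(t)\in C_x$ for all $t\in\operatorname{int}(\operatorname{dom}x)$, and $\dot x(t)\in G(x(t))$ for almost all $t\in\operatorname{dom}x$. Given $X_o\subseteq C_x$ and $X_u\subseteq\mathbb R^n$ with $X_o\cap X_u=\emptyset$, the inclusion is *safe* with respect to $(X_o,X_u)$ if every solution with $x(0)\in X_o$ satisfies $x(t)\notin X_u$ for all $t\in\operatorname{dom}x$. **Theorem.** Let $X_o\subseteq C_x$, $X_u\subseteq\mathbb R^n$, and let $B:\mathbb R^n\to\mathbb R$ be a locally Lipschitz control barrier function with respect to $(X_o,X_u)$;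 that is, $B>0$ on $X_u$, $B\le0$ on $X_o$, and, with $K=\{x\in C_x:B(x)\le0\}$, there is an open neighbourhood $U_1$ of $\partial K$ such that $\inf_{u\in\mathcal U(x)}g(x,u)\le0$ for all $x\in(U_1\setminus\operatorname{int}K)\cap C_x$. Suppose there is an open neighbourhood $U$ of $\partial K$ such that $D_0(x)\neq\emptyset$ for all $x\in(U\setminus\operatorname{int}K)\cap C_x$. Then there exists a continuous $\kappa:C_x\to C_u$ with $\kappa(x)\in\mathcal U(x)$ for all $x\in C_x$ such that the closed-loop inclusion $\dot x\in F(x,\kappa(x))$, $x\in C_x$, is safe with respect to $(X_o,X_u)$. In other words, $\kappa$ makes the system controlled safe with respect to $(X_o,X_u)$. -/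

import Mathlib

open Set Filter Topology MeasureTheory
open scoped Pointwise

noncomputable section

namespace SafeControl

/-- Euclidean space of dimension `n`. -/
abbrev Euc (n : ℕ) : Type := EuclideanSpace ℝ (Fin n)

variable {n m : ℕ}

/-! ### Set-valued maps -/

/-- Upper semicontinuity of a set-valued map relative to its domain `C`: for all `x ∈ C` and
`ε > 0`, all points `y ∈ C` near `x` satisfy `G y ⊆ G x + ε 𝔹`. -/
def UpperSemicontOn {X : Type*} [TopologicalSpace X] (G : X → Set (Euc n)) (C : Set X) : Prop :=
  ∀ x ∈ C, ∀ ε : ℝ, 0 < ε → ∀ᶠ y in 𝓝[C] x, G y ⊆ G x + Metric.closedBall (0 : Euc n) ε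

/-- A set-valued map `G` on the convex set `X` is convex if
`G (θ u + (1 - θ) v) ⊆ θ G u + (1 - θ) G v` for `u, v ∈ X` and `θ ∈ [0, 1]`. -/
def IsConvexMapOn (X : Set (Euc m)) (G : Euc m → Set (Euc n)) : Prop :=
  Convex ℝ X ∧ ∀ u ∈ X, ∀ v ∈ X, ∀ θ ∈ Icc (0 : ℝ) 1,
    G (θ • u + (1 - θ) • v) ⊆ θ • G u + (1 - θ) • G v

/-- Open neighbourhoods of a set. -/
def IsOpenNhd (U A : Set (Euc n)) : Prop := IsOpen U ∧ A ⊆ U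

/-! ### The Clarke generalized gradient -/

/-- The Clarke generalized gradient of `B` at `x`: the convex hull of all limits of gradients
`∇B(x_i)` along sequences `x_i → x` of points of differentiability of `B` that avoid `Ω`.
Here `Ω` is an arbitrary Lebesgue null set. -/
def clarkeGradient (Ω : Set (Euc n)) (B : Euc n → ℝ) (x : Euc n) : Set (Euc n) :=
  convexHull ℝ {ζ | ∃ p : ℕ → Euc n, Tendsto p atTop (𝓝 x) ∧
    (∀ i, DifferentiableAt ℝ B (p i) ∧ p i ∉ Ω) ∧
    Tendsto (fun i => gradient B (p i)) atTop (𝓝 ζ)}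

/-! ### Constrained differential inclusions and safety -/

/-- `x`, with domain `dom`, is a solution of `ẋ ∈ G x`, `x ∈ Cx`. The domain is an interval of
`[0, ∞)` that contains `0` (possibly only `{0}`). Only the values of `x` on `dom` matter, because
the boundary of an interval is a null set. -/
structure IsSolution (Cx : Set (Euc n)) (G : Euc n → Set (Euc n))
    (dom : Set ℝ) (x : ℝ → Euc n) : Prop where
  dom_subset : dom ⊆ Ici 0
  dom_interval : dom.OrdConnected
  zero_mem : (0 : ℝ) ∈ dom
  init : x 0 ∈ closure Cx
  /-- local absolute continuity: absolute continuity on each compact subinterval -/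
  abs_cont : ∀ a ∈ dom, ∀ b ∈ dom, AbsolutelyContinuousOnInterval x a b
  state : ∀ t ∈ interior dom, x t ∈ Cx
  velocity : ∀ᵐ t ∂(volume.restrict dom), ∃ v ∈ G (x t), HasDerivAt x v t

/-- Safety of `ẋ ∈ G x`, `x ∈ Cx` with respect to the initial set `Xo` and the unsafe set `Xu`. -/
structure IsSafe (Cx : Set (Euc n)) (G : Euc n → Set (Euc n)) (Xo Xu : Set (Euc n)) : Prop where
  init_subset : Xo ⊆ Cx
  disjoint : Disjoint Xo Xu
  safe : ∀ (dom : Set ℝ) (x : ℝ → Euc n), IsSolution Cx G dom x → x 0 ∈ Xo →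
    ∀ t ∈ dom, x t ∉ Xu

/-- The feedback `κ` is a selection of `𝒰` on `Cx` whose closed loop `ẋ ∈ F (x, κ x)`, `x ∈ Cx`,
is safe with respect to `(Xo, Xu)`, that is, `κ` makes the system controlled safe. -/
def MakesControlledSafe (Cx : Set (Euc n)) (F : Euc n → Euc m → Set (Euc n))
    (𝒰 : Euc n → Set (Euc m)) (Xo Xu : Set (Euc n)) (κ : Euc n → Euc m) : Prop :=
  (∀ x ∈ Cx, κ x ∈ 𝒰 x) ∧ IsSafe Cx (fun x => F x (κ x)) Xo Xu

/-! ### Control barrier functions -/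

/-- Barrier function candidates. -/
def IsBarrierCandidate (B : Euc n → ℝ) (Xo Xu : Set (Euc n)) : Prop :=
  (∀ x ∈ Xu, 0 < B x) ∧ ∀ x ∈ Xo, B x ≤ 0

/-- The set `K`: the zero sublevel set of `B`, intersected with the state constraint set. -/
def safeSet (B : Euc n → ℝ) (Cx : Set (Euc n)) : Set (Euc n) := {x | B x ≤ 0} ∩ Cx

/-- The supremum `g(x, u)` of `⟨ζ, η⟩` over `ζ ∈ ∂_C B(x)` and `η ∈ F(x, u)`, as an extended
real number. -/
def supRate (Ω : Set (Euc n)) (B : Euc n → ℝ) (F : Euc n → Euc m → Set (Euc n))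
    (x : Euc n) (u : Euc m) : EReal :=
  ⨆ ζ ∈ clarkeGradient Ω B x, ⨆ η ∈ F x u, ((inner ℝ ζ η : ℝ) : EReal)

/-- `B` is a (locally Lipschitz) control barrier function with respect to `(Xo, Xu)`. -/
structure IsCBF (Ω : Set (Euc n)) (Cx : Set (Euc n)) (F : Euc n → Euc m → Set (Euc n))
    (𝒰 : Euc n → Set (Euc m)) (Xo Xu : Set (Euc n)) (B : Euc n → ℝ) : Prop where
  lipschitz : LocallyLipschitz B
  candidate : IsBarrierCandidate B Xo Xu
  decrease : ∃ U : Set (Euc n), IsOpenNhd U (frontier (safeSet B Cx)) ∧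
    ∀ x ∈ (U \ interior (safeSet B Cx)) ∩ Cx, (⨅ u ∈ 𝒰 x, supRate Ω B F x u) ≤ 0

/-- The map `D_γ` of admissible inputs with `g(x, u) + γ(x) < 0`. -/
def safeInputs (Ω : Set (Euc n)) (B : Euc n → ℝ) (F : Euc n → Euc m → Set (Euc n))
    (𝒰 : Euc n → Set (Euc m)) (γ : Euc n → ℝ) (x : Euc n) : Set (Euc m) :=
  {u | u ∈ 𝒰 x ∧ supRate Ω B F x u + (γ x : EReal) < 0}

end SafeControl

end

open SafeControl

/-! It suffices to make the barrier rate negative on `∂K`, which lies in `Cx` because `K` is closed.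

Feedback: negativity of the rate is an open condition on `(x, u)` in `Cx ×ˢ Cu`, since gradients
near `x` are bounded and accumulate in the Clarke gradient while `F` is upper semicontinuous with
compact values. It is a convex condition on `u`, since `F` is convex in `u`. Michael's theorem gives
a local selection through any prescribed good input, and a partition of unity glues these selections
(`exists_continuousOn_selection_supRate_lt_zero`).

Safety: an escaping solution has a last time `t₀` in `K`, and `x t₀ ∈ ∂K`. A chain rule for `B`
along the curve is unavailable, as the curve may stay where `B` is not differentiable. Instead, the
mean velocity on a short `[t₀, t₁]` lies in the convex set `F + ε𝔹` taken at `x t₀`, and a mean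
value inequality in this fixed direction, needing gradients only almost everywhere, makes `B`
decrease. Hence `x t₁ ∈ K`, a contradiction. -/

/-! ### Continuous selections of lower hemicontinuous maps. -/

section Selection

variable {X E : Type*} [TopologicalSpace X] [NormedAddCommGroup E]

/-- Intersecting a lower hemicontinuous map with open balls around a continuous map preserves
lower hemicontinuity. -/
theorem LowerHemicontinuous.inter_ball {Φ : X → Set E} (hΦ : LowerHemicontinuous Φ)
    (f : C(X, E)) (r : ℝ) : LowerHemicontinuous fun x => Φ x ∩ Metric.ball (f x) r := by
  intro x
  refine lowerHemicontinuousAt_iff.2 ?_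
  rintro u hu ⟨y, ⟨hy, hyr⟩, hyu⟩
  rw [Metric.mem_ball] at hyr
  -- Half of the slack pays for moving `y` to `z`, the other half for moving the centre `f x` to `f
  -- x'`.
  set s := (r - dist y (f x)) / 2 with hs
  have hs0 : 0 < s := by rw [hs]; linarith
  have h1 := (lowerHemicontinuousAt_iff.1 (hΦ x)) (u ∩ Metric.ball y s)
    (hu.inter Metric.isOpen_ball) ⟨y, hy, hyu, Metric.mem_ball_self hs0⟩
  have h2 : ∀ᶠ x' in 𝓝 x, dist (f x') (f x) < s :=
    Metric.tendsto_nhds.1 f.continuous.continuousAt s hs0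
  filter_upwards [h1, h2] with x' ⟨z, hz, hzu, hzy⟩ hx'
  refine ⟨z, ⟨hz, ?_⟩, hzu⟩
  rw [Metric.mem_ball] at hzy ⊢
  have := dist_triangle4 z y (f x) (f x')
  rw [dist_comm (f x) (f x')] at this
  linarith

/-- Modifying a lower hemicontinuous map at one point to be a single point of its value preserves
lower hemicontinuity. -/
theorem LowerHemicontinuous.update_singleton [T1Space X] [DecidableEq X] {Φ : X → Set E}
    (hΦ : LowerHemicontinuous Φ) {x₀ : X} {y₀ : E} (hy₀ : y₀ ∈ Φ x₀) :
    LowerHemicontinuous (Function.update Φ x₀ {y₀}) := by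
  intro x
  refine lowerHemicontinuousAt_iff.2 ?_
  intro u hu hne
  by_cases hx : x = x₀
  · subst hx
    rw [Function.update_self] at hne
    obtain ⟨y, rfl, hyu⟩ := hne
    filter_upwards [lowerHemicontinuousAt_iff.1 (hΦ x) u hu ⟨y, hy₀, hyu⟩] with x' hx'
    by_cases h : x' = x
    · subst h
      rw [Function.update_self]
      exact ⟨y, rfl, hyu⟩
    · rwa [Function.update_of_ne h]
  · rw [Function.update_of_ne hx] at hne
    filter_upwards [lowerHemicontinuousAt_iff.1 (hΦ x) u hu hne, isOpen_ne.mem_nhds hx]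
      with x' hx' h
    rwa [Function.update_of_ne h]

variable [NormedSpace ℝ E] [NormalSpace X] [ParacompactSpace X]

/-- A constant `c ∈ Φ x` is an approximate selection near `x`; convexity of the thickened values
lets a partition of unity glue these constants. -/
theorem exists_continuous_forall_mem_thickening {Φ : X → Set E} (hΦ : LowerHemicontinuous Φ)
    (hne : ∀ x, (Φ x).Nonempty) (hconv : ∀ x, Convex ℝ (Φ x)) {r : ℝ} (hr : 0 < r) :
    ∃ f : C(X, E), ∀ x, f x ∈ Metric.thickening r (Φ x) := by
  refine exists_continuous_forall_mem_convex_of_local_const (fun x => (hconv x).thickening r) ?_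
  intro x
  obtain ⟨c, hc⟩ := hne x
  refine ⟨c, ?_⟩
  filter_upwards [lowerHemicontinuousAt_iff.1 (hΦ x) _ Metric.isOpen_ball
    ⟨c, hc, Metric.mem_ball_self hr⟩] with y ⟨z, hz, hzc⟩
  rw [Metric.mem_thickening_iff]
  exact ⟨z, hz, by rwa [dist_comm]⟩

/-- **Michael's selection theorem**: a lower hemicontinuous map on a paracompact normal space with
nonempty closed convex values in a Banach space has a continuous selection. -/
theorem LowerHemicontinuous.exists_continuous_selection [CompleteSpace E] {Φ : X → Set E}
    (hΦ : LowerHemicontinuous Φ) (hne : ∀ x, (Φ x).Nonempty) (hcl : ∀ x, IsClosed (Φ x))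
    (hconv : ∀ x, Convex ℝ (Φ x)) : ∃ f : C(X, E), ∀ x, f x ∈ Φ x := by
  -- The hypothesis on `f` stands inside the existential so that `choose` yields a total map to
  -- iterate. The distance bound comes from `(1/2)^k + (1/2)^(k+1)`.
  have step : ∀ (k : ℕ) (f : C(X, E)), ∃ f' : C(X, E),
      (∀ x, f x ∈ Metric.thickening ((1 / 2 : ℝ) ^ k) (Φ x)) →
      (∀ x, f' x ∈ Metric.thickening ((1 / 2 : ℝ) ^ (k + 1)) (Φ x)) ∧
      ∀ x, dist (f x) (f' x) ≤ 2 * (1 / 2 : ℝ) ^ k := by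
    intro k f
    by_cases hf : ∀ x, f x ∈ Metric.thickening ((1 / 2 : ℝ) ^ k) (Φ x)
    · obtain ⟨f', hf'⟩ := exists_continuous_forall_mem_thickening
        (hΦ.inter_ball f ((1 / 2 : ℝ) ^ k))
        (fun x => by
          obtain ⟨z, hz, hzf⟩ := Metric.mem_thickening_iff.1 (hf x)
          exact ⟨z, hz, by rwa [Metric.mem_ball, dist_comm]⟩)
        (fun x => (hconv x).inter (convex_ball _ _))
        (show (0 : ℝ) < (1 / 2) ^ (k + 1) by positivity)
      refine ⟨f', fun _ => ⟨fun x => Metric.thickening_subset_of_subset _ inter_subset_left (hf' x),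
        fun x => ?_⟩⟩
      obtain ⟨z, ⟨-, hz⟩, hzf⟩ := Metric.mem_thickening_iff.1 (hf' x)
      rw [Metric.mem_ball] at hz
      have h1 := dist_triangle (f x) z (f' x)
      rw [dist_comm (f x) z, dist_comm z (f' x)] at h1
      have h2 : (0 : ℝ) < (1 / 2) ^ k := by positivity
      rw [pow_succ] at hzf
      linarith
    · exact ⟨f, fun h => absurd h hf⟩
  choose nxt hnxt using step
  obtain ⟨f₀, hf₀⟩ := exists_continuous_forall_mem_thickening hΦ hne hconv one_pos
  let f : ℕ → C(X, E) := fun k => Nat.rec f₀ nxt k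
  have hf : ∀ k x, f k x ∈ Metric.thickening ((1 / 2 : ℝ) ^ k) (Φ x) := by
    intro k
    induction k with
    | zero => rw [pow_zero]; exact hf₀
    | succ k ih => exact (hnxt k (f k) ih).1
  have hd : ∀ x k, dist (f k x) (f (k + 1) x) ≤ 2 * (1 / 2 : ℝ) ^ k := fun x k =>
    (hnxt k (f k) (hf k)).2 x
  have hlim : ∀ x, ∃ y, Tendsto (fun k => f k x) atTop (𝓝 y) := fun x =>
    cauchySeq_tendsto_of_complete (cauchySeq_of_le_geometric (1 / 2) 2 (by norm_num) (hd x))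
  choose g hg using hlim
  have hdist : ∀ x k, dist (f k x) (g x) ≤ 4 * (1 / 2 : ℝ) ^ k := fun x k =>
    (dist_le_of_le_geometric_of_tendsto (1 / 2) 2 (by norm_num) (hd x) (hg x) k).trans_eq (by ring)
  have hpow : Tendsto (fun k : ℕ => (1 / 2 : ℝ) ^ k) atTop (𝓝 0) :=
    tendsto_pow_atTop_nhds_zero_of_lt_one (by norm_num) (by norm_num)
  have hunif : TendstoUniformly (fun k x => f k x) g atTop := by
    rw [Metric.tendstoUniformly_iff]
    intro ε hε
    filter_upwards [hpow.eventually_lt_const (show (0 : ℝ) < ε / 4 by positivity)] with k hk x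
    rw [dist_comm]
    have := hdist x k
    linarith
  refine ⟨⟨g, hunif.continuous (Frequently.of_forall fun k => (f k).continuous)⟩, fun x => ?_⟩
  choose z hz hzf using fun k => Metric.mem_thickening_iff.1 (hf k x)
  refine (hcl x).mem_of_tendsto (f := z) (b := atTop) ?_ (Eventually.of_forall hz)
  have h0 : Tendsto (fun k => dist (f k x) (z k)) atTop (𝓝 0) :=
    squeeze_zero (fun _ => dist_nonneg) (fun k => (hzf k).le) hpow
  exact (tendsto_iff_of_dist h0).1 (hg x)

end Selection

/-! ### Mean value inequalities for Lipschitz functions and absolutely continuous curves. -/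

section MeanValue

/-- Mean value inequality for Lipschitz functions whose derivative in the direction `v` is bounded
above almost everywhere on an open convex set. -/
theorem LipschitzWith.sub_le_of_ae_fderiv_le {E : Type*} [NormedAddCommGroup E] [NormedSpace ℝ E]
    [FiniteDimensional ℝ E] [MeasurableSpace E] [BorelSpace E] (μ : Measure E) [μ.IsAddHaarMeasure]
    {K : NNReal} {g : E → ℝ} (hg : LipschitzWith K g) {W : Set E} (hWo : IsOpen W)
    (hWc : Convex ℝ W) {v : E} {c : ℝ} (hc : ∀ᵐ y ∂μ, y ∈ W → fderiv ℝ g y v ≤ c)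
    {y : E} (hy : y ∈ W) (hyv : y + v ∈ W) : g (y + v) - g y ≤ c := by
  by_contra! hlt
  obtain ⟨d, hcd, hd⟩ := exists_between hlt
  have hcont := hg.continuous
  have h1 : ∀ᶠ z in 𝓝 y, z ∈ W ∧ z + v ∈ W ∧ d < g (z + v) - g z := by
    refine (hWo.eventually_mem hy).and (Filter.Eventually.and ?_ ?_)
    · exact (continuous_id.add continuous_const).continuousAt.eventually_mem (hWo.mem_nhds hyv)
    · exact ((by fun_prop : Continuous fun z => g (z + v) - g z).continuousAt).eventually_const_lt hd
  obtain ⟨r, hr, hball⟩ := Metric.eventually_nhds_iff_ball.1 h1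
  set A := Metric.ball y r
  have hAfin : μ A ≠ ⊤ := measure_ball_lt_top.ne
  have hApos : 0 < μ.real A := ENNReal.toReal_pos (Metric.measure_ball_pos μ y hr).ne' hAfin
  have hint : ∀ s : ℝ, IntegrableOn (fun z => g (z + s • v)) A μ := fun s =>
    ((by fun_prop : Continuous fun z => g (z + s • v)).continuousOn.integrableOn_compact
      (isCompact_closedBall y r)).mono_set Metric.ball_subset_closedBall
  -- A single segment may miss every point of differentiability. Averaging over starting points in
  -- `A` avoids this: for each fixed `s`, translation by `s • v` preserves null sets, so
  -- Rademacher's theorem applies at almost every `z + s • v`.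
  have hderiv : ∀ s : ℝ, HasDerivAt (fun s => ∫ z in A, g (z + s • v) ∂μ)
      (∫ z in A, fderiv ℝ g (z + s • v) v ∂μ) s ∧
      IntegrableOn (fun z => fderiv ℝ g (z + s • v) v) A μ := by
    intro s
    have hae : ∀ᵐ z ∂μ, DifferentiableAt ℝ g (z + s • v) :=
      (quasiMeasurePreserving_add_right μ (s • v)).ae (hg.ae_differentiableAt (μ := μ))
    refine (hasDerivAt_integral_of_dominated_loc_of_lip (μ := μ.restrict A)
      (F := fun s z => g (z + s • v)) (bound := fun _ => K * ‖v‖) (s := univ) univ_mem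
      (Eventually.of_forall fun s => (hint s).aestronglyMeasurable) (hint s) ?_ ?_ ?_ ?_).symm
    · exact ((measurable_fderiv_apply_const ℝ g v).comp
        (measurable_id.add_const _)).aestronglyMeasurable
    · refine Eventually.of_forall fun z => LipschitzOnWith.of_dist_le_mul fun a _ b _ => ?_
      refine (hg.dist_le_mul _ _).trans ?_
      rw [dist_add_left, dist_eq_norm, ← sub_smul, norm_smul, Real.coe_nnabs,
        abs_of_nonneg (by positivity), Real.dist_eq, Real.norm_eq_abs]
      exact le_of_eq (by ring)
    · exact integrableOn_const hAfin
    · filter_upwards [ae_restrict_of_ae hae] with z hz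
      have h2 : HasDerivAt (fun s : ℝ => z + s • v) v s := by
        simpa using ((hasDerivAt_id s).smul_const v).const_add z
      exact hz.hasFDerivAt.comp_hasDerivAt s h2
  have hle : ∀ s ∈ interior (Icc (0 : ℝ) 1),
      deriv (fun s => ∫ z in A, g (z + s • v) ∂μ) s ≤ c * μ.real A := by
    intro s hs
    have hs := interior_subset hs
    rw [(hderiv s).1.deriv]
    have hae : ∀ᵐ z ∂μ, z + s • v ∈ W → fderiv ℝ g (z + s • v) v ≤ c :=
      (quasiMeasurePreserving_add_right μ (s • v)).ae hc
    calc ∫ z in A, fderiv ℝ g (z + s • v) v ∂μ ≤ ∫ _ in A, c ∂μ := by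
          refine integral_mono_ae (hderiv s).2 (integrableOn_const hAfin) ?_
          filter_upwards [ae_restrict_of_ae hae, ae_restrict_mem measurableSet_ball] with z hz hzA
          refine hz ?_
          have := hWc (hball z hzA).1 (hball z hzA).2.1 (sub_nonneg.2 hs.2) hs.1 (by ring)
          convert this using 1
          module
      _ = c * μ.real A := by rw [setIntegral_const, smul_eq_mul, mul_comm]
  have hmv := (convex_Icc (0 : ℝ) 1).image_sub_le_mul_sub_of_deriv_le
    (fun s _ => (hderiv s).1.continuousAt.continuousWithinAt)
    (fun s _ => (hderiv s).1.differentiableAt.differentiableWithinAt) hle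
    0 (by simp) 1 (by simp) zero_le_one
  have hge : d * μ.real A ≤ (∫ z in A, g (z + (1 : ℝ) • v) ∂μ) - ∫ z in A, g (z + (0 : ℝ) • v) ∂μ := by
    rw [← integral_sub (hint 1) (hint 0)]
    calc d * μ.real A = ∫ _ in A, d ∂μ := by rw [setIntegral_const, smul_eq_mul, mul_comm]
      _ ≤ _ := by
          refine setIntegral_mono_on (integrableOn_const hAfin) ((hint 1).sub (hint 0))
            measurableSet_ball fun z hz => ?_
          simpa using (hball z hz).2.2.le
  nlinarith

/-- An absolutely continuous curve whose velocity lies in a closed convex set almost everywhere has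
its mean velocity in that set. -/
theorem AbsolutelyContinuousOnInterval.slope_mem {E : Type*} [NormedAddCommGroup E]
    [NormedSpace ℝ E] {x : ℝ → E} {a b : ℝ} (hab : a < b)
    (hx : AbsolutelyContinuousOnInterval x a b) {S : Set E} (hSc : Convex ℝ S) (hS : IsClosed S)
    (hv : ∀ᵐ t, t ∈ Ioc a b → ∃ v ∈ S, HasDerivAt x v t) : (b - a)⁻¹ • (x b - x a) ∈ S := by
  by_contra hnot
  -- Separation reduces the claim to the scalar function `f ∘ x`, the integral of its derivative.
  obtain ⟨f, u, hfS, hfu⟩ := geometric_hahn_banach_closed_point hSc hS hnot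
  have hac : AbsolutelyContinuousOnInterval (fun t => f (x t)) a b := by
    have h0 : Tendsto (fun E : ℕ × (ℕ → ℝ × ℝ) =>
        ‖f‖ * ∑ i ∈ Finset.range E.1, dist (x (E.2 i).1) (x (E.2 i).2))
        (AbsolutelyContinuousOnInterval.totalLengthFilter ⊓
          𝓟 (AbsolutelyContinuousOnInterval.disjWithin a b)) (𝓝 0) := by
      simpa using Tendsto.const_mul ‖f‖ hx
    refine squeeze_zero (fun _ => Finset.sum_nonneg fun _ _ => dist_nonneg) (fun E => ?_) h0
    rw [Finset.mul_sum]
    exact Finset.sum_le_sum fun i _ => f.dist_le_opNorm _ _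
  have hint := hac.integral_deriv_eq_sub
  have hle : ∫ t in a..b, deriv (fun t => f (x t)) t ≤ ∫ _ in a..b, u := by
    rw [intervalIntegral.integral_of_le hab.le, intervalIntegral.integral_of_le hab.le]
    refine integral_mono_ae ((intervalIntegrable_iff_integrableOn_Ioc_of_le hab.le).1
      hac.intervalIntegrable_deriv) (by simp) ?_
    filter_upwards [ae_restrict_of_ae hv, ae_restrict_mem measurableSet_Ioc] with t ht htm
    obtain ⟨v, hvS, hvd⟩ := ht htm
    have hd : HasDerivAt (fun t => f (x t)) (f v) t := f.hasFDerivAt.comp_hasDerivAt t hvd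
    exact hd.deriv.trans_le (hfS v hvS).le
  rw [hint, intervalIntegral.integral_const, smul_eq_mul] at hle
  rw [map_smul, map_sub, smul_eq_mul, lt_inv_mul_iff₀ (sub_pos.2 hab)] at hfu
  linarith

end MeanValue

/-! ### Stability of the negative barrier rate. -/

namespace SafeControl

variable {n m : ℕ}

theorem supRate_lt_zero_iff {Ω : Set (Euc n)} {B : Euc n → ℝ} {F : Euc n → Euc m → Set (Euc n)}
    {x : Euc n} {u : Euc m} : supRate Ω B F x u < 0 ↔
      ∃ c < (0 : ℝ), ∀ ζ ∈ clarkeGradient Ω B x, ∀ η ∈ F x u, inner ℝ ζ η ≤ c := by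
  constructor
  · intro h
    obtain ⟨c, hc, hc0⟩ := EReal.lt_iff_exists_real_btwn.1 h
    refine ⟨c, by exact_mod_cast hc0, fun ζ hζ η hη => ?_⟩
    have : ((inner ℝ ζ η : ℝ) : EReal) ≤ supRate Ω B F x u :=
      le_iSup₂_of_le ζ hζ (le_iSup₂_of_le η hη le_rfl)
    exact_mod_cast this.trans hc.le
  · rintro ⟨c, hc, h⟩
    refine lt_of_le_of_lt (b := (c : EReal)) ?_ (by exact_mod_cast hc)
    exact iSup₂_le fun ζ hζ => iSup₂_le fun η hη => by exact_mod_cast h ζ hζ η hη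

/-- A velocity at a mixed input is the same mixture of velocities at the two inputs, so the larger
of the two negative bounds still holds. -/
theorem convex_setOf_supRate_lt_zero {Ω : Set (Euc n)} {B : Euc n → ℝ}
    {F : Euc n → Euc m → Set (Euc n)} {x : Euc n} {C : Set (Euc m)} (hF : IsConvexMapOn C (F x)) :
    Convex ℝ {u | u ∈ C ∧ supRate Ω B F x u < 0} := by
  rintro u ⟨hu, hgu⟩ v ⟨hv, hgv⟩ a b ha hb hab
  refine ⟨hF.1 hu hv ha hb hab, ?_⟩
  obtain rfl : b = 1 - a := by linarith
  obtain ⟨c, hc, hcu⟩ := supRate_lt_zero_iff.1 hgu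
  obtain ⟨d, hd, hdv⟩ := supRate_lt_zero_iff.1 hgv
  refine supRate_lt_zero_iff.2 ⟨max c d, max_lt hc hd, fun ζ hζ η hη => ?_⟩
  obtain ⟨_, ⟨η₁, h₁, rfl⟩, _, ⟨η₂, h₂, rfl⟩, rfl⟩ := hF.2 u hu v hv a ⟨ha, by linarith⟩ hη
  have e₁ := (hcu ζ hζ η₁ h₁).trans (le_max_left c d)
  have e₂ := (hdv ζ hζ η₂ h₂).trans (le_max_right c d)
  simp only [inner_add_right, inner_smul_right]
  nlinarith [mul_le_mul_of_nonneg_left e₁ ha, mul_le_mul_of_nonneg_left e₂ hb]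

/-- If the supremum of `⟨ζ, η⟩` over the Clarke gradient at `x` and a compact set `S` of velocities
is negative, then it is uniformly so for the gradients at nearby points and velocities near `S`. -/
theorem exists_forall_inner_gradient_le {Ω : Set (Euc n)} {B : Euc n → ℝ}
    (hB : LocallyLipschitz B) {x : Euc n} {S : Set (Euc n)} (hS : IsCompact S)
    (hneg : ∀ ζ ∈ clarkeGradient Ω B x, ∀ η ∈ S, inner ℝ ζ η < 0) :
    ∃ ε > 0, ∀ y ∈ Metric.ball x ε, DifferentiableAt ℝ B y → y ∉ Ω →
      ∀ η ∈ S + Metric.closedBall (0 : Euc n) ε, inner ℝ (gradient B y) η ≤ -ε := by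
  by_contra! hcon
  obtain ⟨K, t, ht, hlip⟩ := hB x
  -- The Lipschitz constant bounds the gradients and `S` is compact, so a subsequence converges; its
  -- limit pairs a Clarke gradient with a point of `S` at a nonnegative value.
  choose y hy hyd hyΩ η hη hlt using fun k : ℕ => hcon (1 / ((k : ℝ) + 1)) (by positivity)
  have hε := tendsto_one_div_add_atTop_nhds_zero_nat (𝕜 := ℝ)
  have hyx : Tendsto y atTop (𝓝 x) :=
    tendsto_iff_dist_tendsto_zero.2 (squeeze_zero (fun _ => dist_nonneg) (fun k => (hy k).le) hε)
  choose s hs b hb hsb using fun k => mem_add.1 (hη k)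
  have hb0 : Tendsto b atTop (𝓝 0) :=
    tendsto_iff_dist_tendsto_zero.2 (squeeze_zero (fun _ => dist_nonneg) (fun k => hb k) hε)
  have hbd : ∃ᶠ k in atTop, (gradient B (y k), s k) ∈ Metric.closedBall (0 : Euc n) K ×ˢ S := by
    refine Eventually.frequently ?_
    filter_upwards [hyx.eventually (eventually_mem_nhds_iff.2 ht)] with k hk
    refine ⟨?_, hs k⟩
    rw [mem_closedBall_zero_iff]
    have := norm_fderiv_le_of_lipschitzOn ℝ hk hlip
    simpa [gradient] using this
  obtain ⟨⟨ζ, σ⟩, ⟨-, hσ⟩, φ, hφ, hlim⟩ :=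
    ((isCompact_closedBall (0 : Euc n) (K : ℝ)).prod hS).tendsto_subseq' hbd
  have hζ : Tendsto (fun k => gradient B (y (φ k))) atTop (𝓝 ζ) :=
    (continuous_fst.tendsto _).comp hlim
  have hs' : Tendsto (fun k => s (φ k)) atTop (𝓝 σ) := (continuous_snd.tendsto _).comp hlim
  have hη' : Tendsto (fun k => η (φ k)) atTop (𝓝 σ) := by
    have := hs'.add (hb0.comp hφ.tendsto_atTop)
    rw [add_zero] at this
    exact this.congr fun k => hsb (φ k)
  have h0 := hneg ζ (subset_convexHull ℝ _ ⟨fun k => y (φ k), hyx.comp hφ.tendsto_atTop,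
    fun k => ⟨hyd _, hyΩ _⟩, hζ⟩) σ hσ
  have h1 : (-0 : ℝ) ≤ inner ℝ ζ σ :=
    le_of_tendsto_of_tendsto' (hε.comp hφ.tendsto_atTop).neg (hζ.inner hη') fun k => (hlt (φ k)).le
  linarith

/-- The inequality `⟨∇B, η⟩ ≤ c` near `x` passes to the Clarke gradient at `x`. -/
theorem inner_clarkeGradient_le {Ω : Set (Euc n)} {B : Euc n → ℝ} {W : Set (Euc n)} (hW : IsOpen W)
    {η : Euc n} {c : ℝ}
    (h : ∀ y ∈ W, DifferentiableAt ℝ B y → y ∉ Ω → inner ℝ (gradient B y) η ≤ c)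
    {x : Euc n} (hx : x ∈ W) : ∀ ζ ∈ clarkeGradient Ω B x, inner ℝ ζ η ≤ c := by
  have hconv : Convex ℝ {ζ : Euc n | inner ℝ ζ η ≤ c} := by
    intro a ha b hb s t hs ht hst
    simp only [mem_ofPred_eq, inner_add_left, inner_smul_left] at *
    have : c = s * c + t * c := by rw [← add_mul, hst, one_mul]
    rw [this]
    exact add_le_add (mul_le_mul_of_nonneg_left ha hs) (mul_le_mul_of_nonneg_left hb ht)
  refine fun ζ hζ => convexHull_min ?_ hconv hζ
  rintro ζ ⟨p, hp, hpd, hlim⟩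
  refine le_of_tendsto (hlim.inner (𝕜 := ℝ) (tendsto_const_nhds (x := η))) ?_
  filter_upwards [hp.eventually (hW.mem_nhds hx)] with i hi
  exact h _ hi (hpd i).1 (hpd i).2

/-- This openness keeps the rate negative along a continuous selection near a point where it is
negative. -/
theorem eventually_supRate_lt_zero {Ω : Set (Euc n)} {B : Euc n → ℝ}
    (hB : LocallyLipschitz B) {F : Euc n → Euc m → Set (Euc n)} {C : Set (Euc n × Euc m)}
    (hF : UpperSemicontOn (fun p : Euc n × Euc m => F p.1 p.2) C)
    {x : Euc n} {u : Euc m} (hxu : (x, u) ∈ C) (hcomp : IsCompact (F x u))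
    (hneg : supRate Ω B F x u < 0) : ∀ᶠ p in 𝓝[C] (x, u), supRate Ω B F p.1 p.2 < 0 := by
  obtain ⟨c, hc, h⟩ := supRate_lt_zero_iff.1 hneg
  obtain ⟨ε, hε, hgrad⟩ := exists_forall_inner_gradient_le hB hcomp
    fun ζ hζ η hη => (h ζ hζ η hη).trans_lt hc
  have hball : ∀ᶠ p in 𝓝[C] (x, u), p.1 ∈ Metric.ball x ε :=
    (continuous_fst.tendsto (x, u)).mono_left nhdsWithin_le_nhds (Metric.ball_mem_nhds x hε)
  filter_upwards [hball, hF _ hxu ε hε] with p hp hsub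
  refine supRate_lt_zero_iff.2 ⟨-ε, neg_lt_zero.2 hε, fun ζ hζ η hη => ?_⟩
  exact inner_clarkeGradient_le Metric.isOpen_ball
    (fun y hy hd hΩ => hgrad y hy hd hΩ η (hsub hη)) hp ζ hζ

/-- Mean value inequality for a locally Lipschitz function near a point: its increments are bounded
by a bound for its gradients outside of a null set. -/
theorem exists_ball_sub_le_of_inner_gradient_le {Ω : Set (Euc n)} (hΩ : volume Ω = 0)
    {B : Euc n → ℝ} (hB : LocallyLipschitz B) (x : Euc n) :
    ∃ r > 0, ∀ ε ∈ Ioc 0 r, ∀ v c,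
      (∀ y ∈ Metric.ball x ε, DifferentiableAt ℝ B y → y ∉ Ω → inner ℝ (gradient B y) v ≤ c) →
      x + v ∈ Metric.ball x ε → B (x + v) - B x ≤ c := by
  obtain ⟨K, t, ht, hlip⟩ := hB x
  obtain ⟨r, hr, hrt⟩ := Metric.mem_nhds_iff.1 ht
  -- The global mean value inequality applies to a Lipschitz extension; it agrees with `B` on an
  -- open ball, hence has the same derivatives there.
  obtain ⟨g, hg, hBg⟩ := (hlip.mono hrt).extend_real
  refine ⟨r, hr, fun ε hε v c hgrad hxv => ?_⟩
  have hsub : Metric.ball x ε ⊆ Metric.ball x r := Metric.ball_subset_ball hε.2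
  have hx : x ∈ Metric.ball x ε := Metric.mem_ball_self hε.1
  rw [hBg (hsub hxv), hBg (hsub hx)]
  refine hg.sub_le_of_ae_fderiv_le volume Metric.isOpen_ball (convex_ball x ε) ?_ hx hxv
  filter_upwards [hg.ae_differentiableAt (μ := volume), measure_eq_zero_iff_ae_notMem.1 hΩ]
    with y hyd hyΩ hy
  have heq : B =ᶠ[𝓝 y] g := hBg.eventuallyEq_of_mem (Metric.isOpen_ball.mem_nhds (hsub hy))
  have := hgrad y hy (hyd.congr_of_eventuallyEq heq) hyΩ
  rwa [inner_gradient_left, heq.fderiv_eq] at this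

end SafeControl

/-! ### The safe feedback and the invariance argument. -/

namespace SafeControl

variable {n m : ℕ}

theorem isClosed_safeSet {B : Euc n → ℝ} (hB : Continuous B) {Cx : Set (Euc n)}
    (hCx : IsClosed Cx) : IsClosed (safeSet B Cx) :=
  (isClosed_le hB continuous_const).inter hCx

/-- A lower hemicontinuous map of admissible inputs has a continuous selection whose barrier rate
is negative on a closed set on which every admissible input set contains such an input. -/
theorem exists_continuousOn_selection_supRate_lt_zero {Ω : Set (Euc n)} {B : Euc n → ℝ}
    {Cx : Set (Euc n)} {Cu : Set (Euc m)} {F : Euc n → Euc m → Set (Euc n)}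
    {𝒰 : Euc n → Set (Euc m)}
    (hF : UpperSemicontOn (fun p : Euc n × Euc m => F p.1 p.2) (Cx ×ˢ Cu))
    (hF_comp : ∀ x ∈ Cx, ∀ u ∈ Cu, IsCompact (F x u))
    (h𝒰_sub : ∀ x ∈ Cx, 𝒰 x ⊆ Cu) (h𝒰_lsc : LowerHemicontinuousOn 𝒰 Cx)
    (h𝒰_val : ∀ x ∈ Cx, (𝒰 x).Nonempty ∧ IsClosed (𝒰 x) ∧ Convex ℝ (𝒰 x))
    (hF_conv : ∀ x ∈ Cx, IsConvexMapOn Cu (F x)) (hB : LocallyLipschitz B)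
    {A : Set (Euc n)} (hA : IsClosed A) (hACx : A ⊆ Cx)
    (hD : ∀ x ∈ A, ∃ u ∈ 𝒰 x, supRate Ω B F x u < 0) :
    ∃ κ : Euc n → Euc m, ContinuousOn κ Cx ∧ (∀ x ∈ Cx, κ x ∈ 𝒰 x) ∧
      ∀ x ∈ A, supRate Ω B F x (κ x) < 0 := by
  classical
  have hlsc : LowerHemicontinuous (Cx.domRestrict 𝒰) := lowerHemicontinuous_restrict_iff.2 h𝒰_lsc
  obtain ⟨g, hg⟩ : ∃ g : C(Cx, Euc m), ∀ x : Cx,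
      g x ∈ {u | u ∈ 𝒰 x ∧ ((x : Euc n) ∈ A → supRate Ω B F x u < 0)} := by
    -- The rate is constrained only on `A`. As `A` is closed, the constraint is void near points
    -- outside it.
    refine exists_continuous_forall_mem_convex_of_local (fun x => ?_) fun x => ?_
    · by_cases hx : (x : Euc n) ∈ A
      · intro u hu v hv a b ha hb hab
        refine ⟨(h𝒰_val x x.2).2.2 hu.1 hv.1 ha hb hab, fun _ => ?_⟩
        exact (convex_setOf_supRate_lt_zero (hF_conv x x.2) ⟨h𝒰_sub x x.2 hu.1, hu.2 hx⟩
          ⟨h𝒰_sub x x.2 hv.1, hv.2 hx⟩ ha hb hab).2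
      · simpa [hx] using (h𝒰_val x x.2).2.2
    · obtain ⟨u, hu, hneg⟩ : ∃ u ∈ 𝒰 x, (x : Euc n) ∈ A → supRate Ω B F x u < 0 := by
        by_cases hx : (x : Euc n) ∈ A
        · obtain ⟨u, hu, hneg⟩ := hD x hx
          exact ⟨u, hu, fun _ => hneg⟩
        · obtain ⟨u, hu⟩ := (h𝒰_val x x.2).1
          exact ⟨u, hu, fun h => absurd h hx⟩
      -- Shrinking the value at `x` to `{u}` forces the selection through the good input `u`.
      have hval : ∀ y : Cx, (Function.update (Cx.domRestrict 𝒰) x {u} y).Nonempty ∧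
          IsClosed (Function.update (Cx.domRestrict 𝒰) x {u} y) ∧
          Convex ℝ (Function.update (Cx.domRestrict 𝒰) x {u} y) ∧
          Function.update (Cx.domRestrict 𝒰) x {u} y ⊆ 𝒰 y := by
        intro y
        by_cases hy : y = x
        · subst hy
          rw [Function.update_self]
          exact ⟨singleton_nonempty u, isClosed_singleton, convex_singleton u,
            singleton_subset_iff.2 hu⟩
        · rw [Function.update_of_ne hy]
          exact ⟨(h𝒰_val y y.2).1, (h𝒰_val y y.2).2.1, (h𝒰_val y y.2).2.2, Subset.rfl⟩
      obtain ⟨g, hg⟩ := (hlsc.update_singleton (x₀ := x) (y₀ := u) hu).exists_continuous_selection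
        (fun y => (hval y).1) (fun y => (hval y).2.1) fun y => (hval y).2.2.1
      have hg𝒰 : ∀ y : Cx, g y ∈ 𝒰 y := fun y => (hval y).2.2.2 (hg y)
      have hgx : g x = u := by simpa using hg x
      have hev : ∀ᶠ y : Cx in 𝓝 x, (y : Euc n) ∈ A → supRate Ω B F y (g y) < 0 := by
        by_cases hx : (x : Euc n) ∈ A
        · have hmem : ((x : Euc n), u) ∈ Cx ×ˢ Cu := ⟨x.2, h𝒰_sub x x.2 hu⟩
          have htend : Tendsto (fun y : Cx => ((y : Euc n), g y)) (𝓝 x)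
              (𝓝[Cx ×ˢ Cu] ((x : Euc n), u)) := by
            refine tendsto_nhdsWithin_iff.2 ⟨?_, Eventually.of_forall fun y =>
              ⟨y.2, h𝒰_sub y y.2 (hg𝒰 y)⟩⟩
            rw [← hgx]
            exact (continuous_subtype_val.prodMk g.continuous).tendsto x
          filter_upwards [htend.eventually (eventually_supRate_lt_zero hB hF hmem
            (hF_comp x x.2 u hmem.2) (hneg hx))] with y hy _ using hy
        · filter_upwards [continuous_subtype_val.continuousAt.eventually_mem
            (hA.isOpen_compl.mem_nhds hx)] with y hy h using absurd h hy
      exact ⟨_, hev, g, g.continuous.continuousOn, fun y hy => ⟨hg𝒰 y, hy⟩⟩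
  refine ⟨fun x => if h : x ∈ Cx then g ⟨x, h⟩ else 0, ?_, fun x hx => ?_, fun x hx => ?_⟩
  · rw [continuousOn_iff_continuous_domRestrict]
    refine g.continuous.congr fun x => ?_
    simp
  · simpa [hx] using (hg ⟨x, hx⟩).1
  · simpa [hACx hx] using (hg ⟨x, hACx hx⟩).2 hx

/-- A continuous feedback whose barrier rate is negative on the boundary of the safe set makes the
closed loop safe. -/
theorem isSafe_of_supRate_lt_zero {Ω : Set (Euc n)} (hΩ : volume Ω = 0) {B : Euc n → ℝ}
    {Cx : Set (Euc n)} {Cu : Set (Euc m)} {F : Euc n → Euc m → Set (Euc n)}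
    {Xo Xu : Set (Euc n)} {κ : Euc n → Euc m} (hCx : IsClosed Cx)
    (hF : UpperSemicontOn (fun p : Euc n × Euc m => F p.1 p.2) (Cx ×ˢ Cu))
    (hF_val : ∀ x ∈ Cx, ∀ u ∈ Cu, IsCompact (F x u) ∧ Convex ℝ (F x u))
    (hB : LocallyLipschitz B) (hcand : IsBarrierCandidate B Xo Xu) (hXo : Xo ⊆ Cx)
    (hκ : ContinuousOn κ Cx) (hκCu : MapsTo κ Cx Cu)
    (hneg : ∀ x ∈ frontier (safeSet B Cx), supRate Ω B F x (κ x) < 0) :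
    IsSafe Cx (fun x => F x (κ x)) Xo Xu := by
  refine ⟨hXo, disjoint_left.2 fun x ho hu => (hcand.1 x hu).not_ge (hcand.2 x ho), ?_⟩
  intro dom x hx hx0 T hT hTu
  have hBT : 0 < B (x T) := hcand.1 _ hTu
  have hT0 : 0 < T := by
    refine lt_of_le_of_ne (hx.dom_subset hT) fun h => ?_
    rw [← h] at hBT
    exact hBT.not_ge (hcand.2 _ hx0)
  have hdom : Icc 0 T ⊆ dom := hx.dom_interval.out hx.zero_mem hT
  have hac := hx.abs_cont 0 hx.zero_mem T hT
  have hcont : ContinuousOn x (Icc 0 T) := by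
    simpa [uIcc_of_le hT0.le] using hac.continuousOn
  -- Solutions satisfy the constraint only at interior times; closedness of `Cx` and continuity add
  -- the endpoints.
  have hstate : MapsTo x (Icc 0 T) Cx := by
    have h1 : MapsTo x (Ioo 0 T) Cx := fun t ht => hx.state t
      (interior_mono hdom (by rwa [interior_Icc]))
    have h2 := h1.closure_of_continuousOn (by rwa [closure_Ioo hT0.ne])
    rwa [closure_Ioo hT0.ne, hCx.closure_eq] at h2
  have hK := isClosed_safeSet hB.continuous hCx
  have hcompact : IsCompact (Icc 0 T ∩ x ⁻¹' safeSet B Cx) :=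
    isCompact_Icc.of_isClosed_subset (hcont.preimage_isClosed_of_isClosed isClosed_Icc hK)
      inter_subset_left
  -- `t₀` is the last time in `K` before `T`.
  obtain ⟨t₀, ⟨ht₀, hKt₀⟩, hmax⟩ := hcompact.exists_isGreatest
    ⟨0, left_mem_Icc.2 hT0.le, hcand.2 _ hx0, hXo hx0⟩
  have hout : ∀ t ∈ Ioc t₀ T, x t ∉ safeSet B Cx := fun t ht hKt =>
    ht.1.not_ge (hmax ⟨⟨ht₀.1.trans ht.1.le, ht.2⟩, hKt⟩)
  have ht₀T : t₀ < T := by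
    refine lt_of_le_of_ne ht₀.2 fun h => ?_
    rw [h] at hKt₀
    exact hBT.not_ge hKt₀.1
  have hlocal : ∀ P : ℝ → Prop, (∀ᶠ t in 𝓝[Icc 0 T] t₀, P t) →
      ∃ t₁ ∈ Ioc t₀ T, ∀ t ∈ Icc t₀ t₁, P t := by
    intro P hP
    obtain ⟨η, hη, hPη⟩ := Metric.mem_nhdsWithin_iff.1 hP
    refine ⟨min T (t₀ + η / 2), ⟨lt_min ht₀T (by linarith), min_le_left _ _⟩, fun t ht => ?_⟩
    have h1 := ht.2.trans (min_le_left _ _)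
    have h2 := ht.2.trans (min_le_right _ _)
    refine hPη ⟨?_, ht₀.1.trans ht.1, h1⟩
    rw [Metric.mem_ball, Real.dist_eq, abs_of_nonneg (sub_nonneg.2 ht.1)]
    linarith
  have hfr : x t₀ ∈ frontier (safeSet B Cx) := by
    refine ⟨subset_closure hKt₀, fun hint => ?_⟩
    obtain ⟨t₁, ht₁, hP⟩ := hlocal (fun t => x t ∈ safeSet B Cx)
      ((hcont t₀ ht₀).eventually_mem (mem_interior_iff_mem_nhds.1 hint))
    exact hout t₁ ht₁ (hP t₁ (right_mem_Icc.2 ht₁.1.le))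
  have hmem : (x t₀, κ (x t₀)) ∈ Cx ×ˢ Cu := ⟨hstate ht₀, hκCu (hstate ht₀)⟩
  obtain ⟨hFc, hFconv⟩ := hF_val _ hmem.1 _ hmem.2
  obtain ⟨c, hc, hrate⟩ := supRate_lt_zero_iff.1 (hneg _ hfr)
  obtain ⟨ε, hε, hgrad⟩ := exists_forall_inner_gradient_le hB hFc
    fun ζ hζ η hη => (hrate ζ hζ η hη).trans_lt hc
  obtain ⟨r, hr, hmean⟩ := exists_ball_sub_le_of_inner_gradient_le hΩ hB (x t₀)
  have hδ : 0 < min ε r := lt_min hε hr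
  set S := F (x t₀) (κ (x t₀)) + Metric.closedBall (0 : Euc n) ε with hSdef
  have htend : Tendsto (fun t => (x t, κ (x t))) (𝓝[Icc 0 T] t₀)
      (𝓝[Cx ×ˢ Cu] (x t₀, κ (x t₀))) := by
    refine tendsto_nhdsWithin_iff.2 ⟨?_, ?_⟩
    · exact (hcont t₀ ht₀).prodMk_nhds ((hκ.comp hcont hstate) t₀ ht₀)
    · filter_upwards [self_mem_nhdsWithin] with t ht using ⟨hstate ht, hκCu (hstate ht)⟩
  obtain ⟨t₁, ht₁, hP⟩ := hlocal
    (fun t => x t ∈ Metric.ball (x t₀) (min ε r) ∧ F (x t) (κ (x t)) ⊆ S)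
    (((hcont t₀ ht₀).eventually_mem (Metric.ball_mem_nhds _ hδ)).and
      (htend.eventually (hF _ hmem ε hε)))
  have hsub : Icc t₀ t₁ ⊆ Icc 0 T := Icc_subset_Icc ht₀.1 ht₁.2
  have hslope : (t₁ - t₀)⁻¹ • (x t₁ - x t₀) ∈ S := by
    refine (hac.mono ?_).slope_mem ht₁.1 (hFconv.add (convex_closedBall _ _))
      (hFc.add (isCompact_closedBall _ _)).isClosed ?_
    · rwa [uIcc_of_le ht₁.1.le, uIcc_of_le hT0.le]
    · have hvel := ae_restrict_of_ae_restrict_of_subset hdom hx.velocity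
      rw [ae_restrict_iff' measurableSet_Icc] at hvel
      filter_upwards [hvel] with t ht htm
      obtain ⟨v, hv, hvd⟩ := ht (hsub (Ioc_subset_Icc_self htm))
      exact ⟨v, (hP t (Ioc_subset_Icc_self htm)).2 hv, hvd⟩
  have hpos : 0 < t₁ - t₀ := sub_pos.2 ht₁.1
  -- The displacement is `t₁ - t₀` times a mean velocity in `S`, whose pairing with each nearby
  -- gradient is at most `-ε`.
  have hdecr := hmean (min ε r) ⟨hδ, min_le_right _ _⟩ (x t₁ - x t₀) ((t₁ - t₀) * -ε)
    (fun y hy hd hyΩ => by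
      have h1 := hgrad y (Metric.ball_subset_ball (min_le_left _ _) hy) hd hyΩ _ hslope
      rw [inner_smul_right, inv_mul_le_iff₀ hpos] at h1
      exact h1)
    (by simpa using (hP t₁ (right_mem_Icc.2 ht₁.1.le)).1)
  rw [add_sub_cancel] at hdecr
  refine hout t₁ ht₁ ⟨?_, hstate (hsub (right_mem_Icc.2 ht₁.1.le))⟩
  have h0 : B (x t₀) ≤ 0 := hKt₀.1
  have := mul_pos hpos hε
  show B (x t₁) ≤ 0
  linarith

end SafeControl

/-! ### The main theorem. -/

theorem theorem1 {n m : ℕ}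
    (Cx : Set (Euc n)) (Cu : Set (Euc m))
    (F : Euc n → Euc m → Set (Euc n)) (𝒰 : Euc n → Set (Euc m))
    (Xo Xu : Set (Euc n)) (B : Euc n → ℝ)
    -- the null set in the definition of the Clarke gradient
    (Ω : Set (Euc n)) (hΩ : volume Ω = 0)
    (hXo : Xo ⊆ Cx)
    -- closed constraint set
    (hC : IsClosed (Cx ×ˢ Cu))
    -- regularity of the right-hand side
    (hF_usc : UpperSemicontOn (fun p : Euc n × Euc m => F p.1 p.2) (Cx ×ˢ Cu))
    (hF_val : ∀ x ∈ Cx, ∀ u ∈ Cu, (F x u).Nonempty ∧ IsCompact (F x u) ∧ Convex ℝ (F x u))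
    -- regularity of the map of admissible inputs
    (h𝒰_sub : ∀ x ∈ Cx, 𝒰 x ⊆ Cu)
    (h𝒰_lsc : LowerHemicontinuousOn 𝒰 Cx)
    (h𝒰_val : ∀ x ∈ Cx, (𝒰 x).Nonempty ∧ IsClosed (𝒰 x) ∧ Convex ℝ (𝒰 x))
    -- convexity of the right-hand side in the input
    (hF_conv : ∀ x ∈ Cx, IsConvexMapOn Cu (F x))
    (hB : IsCBF Ω Cx F 𝒰 Xo Xu B)
    (hD : ∃ U : Set (Euc n), IsOpenNhd U (frontier (safeSet B Cx)) ∧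
      ∀ x ∈ (U \ interior (safeSet B Cx)) ∩ Cx, (safeInputs Ω B F 𝒰 (fun _ => 0) x).Nonempty) :
    ∃ κ : Euc n → Euc m, ContinuousOn κ Cx ∧ MapsTo κ Cx Cu ∧
      MakesControlledSafe Cx F 𝒰 Xo Xu κ := by
  -- Closedness of `Cx` is read off a slice of the closed product, which requires a point `u₀` of
  -- `Cu`; a nonempty `Cx` supplies one.
  obtain rfl | ⟨x₀, hx₀⟩ := Cx.eq_empty_or_nonempty
  · obtain rfl := subset_empty_iff.1 hXo
    exact ⟨fun _ => 0, continuousOn_empty _, mapsTo_empty _ _, fun x hx => hx.elim,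
      ⟨hXo, empty_disjoint _, fun _ _ _ h => h.elim⟩⟩
  obtain ⟨u₀, hu₀⟩ := (h𝒰_val x₀ hx₀).1
  have hCx : IsClosed Cx := by
    have : Cx = (fun x => (x, u₀)) ⁻¹' (Cx ×ˢ Cu) := by
      ext x
      simp [h𝒰_sub x₀ hx₀ hu₀]
    rw [this]
    exact hC.preimage (by fun_prop)
  have hfr : frontier (safeSet B Cx) ⊆ Cx := fun x hx =>
    (isClosed_safeSet hB.lipschitz.continuous hCx).frontier_subset hx |>.2
  obtain ⟨U, ⟨-, hU⟩, hD⟩ := hD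
  obtain ⟨κ, hκ, hκ𝒰, hκneg⟩ := exists_continuousOn_selection_supRate_lt_zero hF_usc
    (fun x hx u hu => (hF_val x hx u hu).2.1) h𝒰_sub h𝒰_lsc h𝒰_val hF_conv hB.lipschitz
    isClosed_frontier hfr (fun x hx => by
      obtain ⟨u, hu, hneg⟩ := hD x ⟨⟨hU hx, hx.2⟩, hfr hx⟩
      exact ⟨u, hu, by simpa using hneg⟩)
  have hκCu : MapsTo κ Cx Cu := fun x hx => h𝒰_sub x hx (hκ𝒰 x hx)
  exact ⟨κ, hκ, hκCu, hκ𝒰, isSafe_of_supRate_lt_zero hΩ hCx hF_usc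
    (fun x hx u hu => (hF_val x hx u hu).2) hB.lipschitz hB.candidate hXo hκ hκCu hκneg⟩
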